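/- A pseudo MV-algebra is an algebra $(M;\oplus,{}^-,{}^\sim,0,1)$ satisfying, with $x\odot y:=(y^-\oplus x^-)^\sim$, the axioms: $x\oplus(y\oplus z)=(x\oplus y)\oplus z$; $x\oplus 0=0\oplus x=x$; $x\oplus 1=1\oplus x=1$; $1^-=1^\sim=0$; $(x^-\oplus y^-)^\sim=(x^\sim\oplus y^\sim)^-$; $x\oplus(x^\sim\odot y)=y\oplus(y^\sim\odot x)=(x\odot y^-)\oplus y=(y\odot x^-)\oplus x$; $x\odot(x^-\oplus y)=(x\oplus y^\sim)\odot y$; $(x^-)^\sim=x$. It is ordered by $x\le y\iff x\oplus(x^\sim\odot y)=y$. It is symmetric if $x^-=x^\sim$ for all $x$, and representable if it is a subdirect product of linearly ordered pseudo MV-algebras. For an $\ell$-group $G$ (not necessarily commutative) with strong unit $u$, $\Gamma(G,u)$ is the pseudo MV-algebra on $[0,u]$ with $x\oplus y=(x+y)\wedge u$, $x^-=u-x$, $x^\sim=-x+u$, and constants $0$ and $u$. A weak square root on $M$ is a map $r:M\to M$ such that $r(x)\odot r(x)=x$ for all $x$, and $y\odot y\le x$ implies $y\le r(x)$ for all $x,y$.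 It is a square root if moreover $r(x^-)=r(x)^-\oplus r(0)$ and $r(x^\sim)=r(0)\oplus r(x)^\sim$ for all $x$. It is strict if $r(0)=r(0)^-$. The partial sum $x+y$ is defined in $M$ iff $x\le y^-$, and then $x+y:=x\oplus y$. Put $0a=0$ and $ka=(k-1)a+a$ for $k\ge1$, whenever the right-hand side is defined. An element $a$ is cyclic of order $k\geq 1$ if $ka$ is defined and $ka=1$. Theorem. Let $M$ be a representable pseudo MV-algebra with $0\ne1$ and let $r:M\to M$ be a map such that either $M$ is symmetric and $r$ is a strict square root on $M$, or $r$ is a strict weak square root on $M$. Then: (1) $M$ contains an isomorphic copy of the MV-algebra $\Gamma(\mathbb D,1)$ of dyadic numbers in the real interval $[0,1]$, where $\mathbb D=\{m/2^k\mid m\in\mathbb Z,\ k\ge0\}$; that is, there is an injective homomorphism of pseudo MV-algebras $\Gamma(\mathbb D,1)\to M$. (2) For each $n\ge1$, $M$ has exactly one cyclic element $a$ of order $2^n$. Under any isomorphism of $M$ with $\Gamma(G,u)$, where $(G,u)$ is a unital $\ell$-group, $a$ corresponds to $u/2^n$, i.e. to the unique element $g\in G$ with $2^n g=u$. -/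

import Mathlib

universe u v

/-- The operations `⊕`, `x⁻` (`lneg`), `x^∼` (`rneg`), `0`, `1` of a pseudo MV-algebra. -/
class PMVOps (M : Type u) extends Zero M, One M where
  oplus : M → M → M
  lneg : M → M
  rneg : M → M

namespace PMVOps

variable {M : Type u} [PMVOps M]

/-- `x ⊙ y = (y⁻ ⊕ x⁻)^∼`. -/
def odot (x y : M) : M := rneg (oplus (lneg y) (lneg x))

end PMVOps

open PMVOps in
/-- Pseudo MV-algebras, with axioms (A1)-(A8) in the usual order. -/
class PseudoMVAlgebra (M : Type u) extends PMVOps M where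
  oplus_assoc : ∀ x y z : M, oplus x (oplus y z) = oplus (oplus x y) z
  oplus_zero : ∀ x : M, oplus x 0 = x
  zero_oplus : ∀ x : M, oplus 0 x = x
  oplus_one : ∀ x : M, oplus x 1 = 1
  one_oplus : ∀ x : M, oplus 1 x = 1
  lneg_one : lneg (1 : M) = 0
  rneg_one : rneg (1 : M) = 0
  rneg_oplus_lneg : ∀ x y : M,
    rneg (oplus (lneg x) (lneg y)) = lneg (oplus (rneg x) (rneg y))
  join_comm : ∀ x y : M, oplus x (odot (rneg x) y) = oplus y (odot (rneg y) x)
  join_eq : ∀ x y : M, oplus y (odot (rneg y) x) = oplus (odot x (lneg y)) y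
  join_comm_right : ∀ x y : M, oplus (odot x (lneg y)) y = oplus (odot y (lneg x)) x
  meet_eq : ∀ x y : M, odot x (oplus (lneg x) y) = odot (oplus x (rneg y)) y
  rneg_lneg : ∀ x : M, rneg (lneg x) = x

namespace PseudoMVAlgebra

open PMVOps

section Basic

variable {M : Type u} [PseudoMVAlgebra M]

/-- The join `x ∨ y`. -/
def join (x y : M) : M := oplus x (odot (rneg x) y)

/-- The lattice order: `x ≤ y` iff `x ∨ y = y`. -/
def Le (x y : M) : Prop := join x y = y

/-- `x → y = x⁻ ⊕ y`. -/
def limp (x y : M) : M := oplus (lneg x) y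

/-- `x ⇝ y = y ⊕ x^∼`. -/
def rimp (x y : M) : M := oplus y (rneg x)

/-- The partial sum `x + y` is defined iff `x ≤ y⁻`; its value is then `x ⊕ y`. -/
def SumDefined (x y : M) : Prop := Le x (lneg y)

/-- `IsMultiple x n y`: the partial multiple `n x` exists and equals `y`, where `0 x = 0` and
`n x = (n - 1) x + x` for `n ≥ 1`. -/
def IsMultiple (x : M) : ℕ → M → Prop
  | 0, y => y = 0
  | n + 1, y => ∃ z, IsMultiple x n z ∧ SumDefined z x ∧ y = oplus z x

/-- `a` is a cyclic element of order `n > 0`: the partial multiple `n a` exists and is `1`. -/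
def IsCyclicElement (a : M) (n : ℕ) : Prop := 0 < n ∧ IsMultiple a n 1

/-- A weak square root: (Sq1) and (Sq2). -/
structure IsWeakSquareRoot (r : M → M) : Prop where
  odot_self : ∀ x, odot (r x) (r x) = x
  le_of_odot_le : ∀ x y, Le (odot y y) x → Le y (r x)

/-- A square root: (Sq1), (Sq2) and (Sq3). -/
structure IsSquareRoot (r : M → M) : Prop extends IsWeakSquareRoot r where
  map_lneg : ∀ x, r (lneg x) = limp (r x) (r 0)
  map_rneg : ∀ x, r (rneg x) = rimp (r x) (r 0)

/-- A (weak) square root `r` is strict if `r(0) = r(0)⁻`. -/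
def IsStrict (r : M → M) : Prop := r 0 = lneg (r 0)

end Basic

/-- `M` is symmetric if `x⁻ = x^∼` for all `x`. -/
def IsSymmetric (M : Type u) [PseudoMVAlgebra M] : Prop := ∀ x : M, rneg x = lneg x

/-- `M` is linearly ordered. -/
def IsChain (M : Type u) [PseudoMVAlgebra M] : Prop := ∀ x y : M, Le x y ∨ Le y x

/-- `f` is a homomorphism of pseudo MV-algebras. -/
structure IsHom {M : Type u} {N : Type v} [PseudoMVAlgebra M] [PseudoMVAlgebra N]
    (f : M → N) : Prop where
  map_oplus : ∀ x y, f (oplus x y) = oplus (f x) (f y)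
  map_lneg : ∀ x, f (lneg x) = lneg (f x)
  map_rneg : ∀ x, f (rneg x) = rneg (f x)
  map_zero : f 0 = 0
  map_one : f 1 = 1

/-- `M` is representable: it is a subdirect product of linearly ordered pseudo MV-algebras `A i`.
The family `f` gives the coordinates of the subdirect embedding of `M` into `∏ i, A i`. (The
`A i` are quotients of `M`, so nothing is lost by keeping them in the universe of `M`.) -/
def IsRepresentable (M : Type u) [PseudoMVAlgebra M] : Prop :=
  ∃ (ι : Type u) (A : ι → Type u) (_ : ∀ i, PseudoMVAlgebra (A i)) (f : ∀ i, M → A i),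
    (∀ i, IsChain (A i)) ∧ (∀ i, IsHom (f i)) ∧ (∀ i, Function.Surjective (f i)) ∧
      ∀ x y, (∀ i, f i x = f i y) → x = y

/-- `e` is a strong unit of the (not necessarily commutative) `ℓ`-group `G`. -/
def IsStrongUnit {G : Type u} [AddGroup G] [Lattice G] (e : G) : Prop :=
  0 ≤ e ∧ ∀ g : G, ∃ n : ℕ, 1 ≤ n ∧ g ≤ n • e

/-- The interval `[0, e]` of the unital `ℓ`-group `(G, e)`, the carrier of `Γ(G, e)`. -/
@[ext]
structure Gamma {G : Type u} [AddGroup G] [Lattice G] (e : G) (he : IsStrongUnit e) : Type u where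
  val : G
  nonneg : 0 ≤ val
  le_unit : val ≤ e

namespace Gamma

variable {G : Type u} [AddGroup G] [Lattice G] [AddLeftMono G] [AddRightMono G]
variable {e : G} {he : IsStrongUnit e}

/-- `x ⊕ y = (x + y) ∧ e`, `x⁻ = e - x`, `x^∼ = -x + e`, with constants `0` and `e`. -/
instance instOps : PMVOps (Gamma e he) where
  zero := ⟨0, le_rfl, he.1⟩
  one := ⟨e, he.1, le_rfl⟩
  oplus x y := ⟨(x.val + y.val) ⊓ e, le_inf (add_nonneg x.nonneg y.nonneg) he.1, inf_le_right⟩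
  lneg x := ⟨e - x.val, sub_nonneg.2 x.le_unit, sub_le_self e x.nonneg⟩
  rneg x := ⟨-x.val + e, by
      have := add_le_add_right x.le_unit (-x.val)
      simpa using this, by
      have := add_le_add_left (neg_nonpos.2 x.nonneg) e
      simpa using this⟩

theorem val_zero : (0 : Gamma e he).val = 0 := rfl

theorem val_one : (1 : Gamma e he).val = e := rfl

theorem val_oplus (x y : Gamma e he) : (oplus x y).val = (x.val + y.val) ⊓ e := rfl

theorem val_lneg (x : Gamma e he) : (lneg x).val = e - x.val := rfl

theorem val_rneg (x : Gamma e he) : (rneg x).val = -x.val + e := rfl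

/-- In `Γ(G, e)` one has `x ⊙ y = (x - e + y) ∨ 0`. -/
theorem val_odot (x y : Gamma e he) : (odot x y).val = (x.val - e + y.val) ⊔ 0 := by
  change -(((e - y.val) + (e - x.val)) ⊓ e) + e = _
  rw [neg_inf, sup_add]
  congr 1
  · simp [sub_eq_add_neg, add_assoc]
  · simp

theorem val_sup_left (x y : Gamma e he) : (oplus x (odot (rneg x) y)).val = x.val ⊔ y.val := by
  rw [val_oplus, val_odot, val_rneg, add_sup]
  simp only [add_sub_cancel_right, add_neg_cancel_left, add_zero]
  rw [inf_eq_left.2 (sup_le y.le_unit x.le_unit), sup_comm]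

theorem val_sup_right (x y : Gamma e he) : (oplus (odot x (lneg y)) y).val = x.val ⊔ y.val := by
  rw [val_oplus, val_odot, val_lneg, sup_add]
  have h : x.val - e + (e - y.val) + y.val = x.val := by simp [sub_eq_add_neg, add_assoc]
  rw [h, zero_add, inf_eq_left.2 (sup_le x.le_unit y.le_unit)]

theorem val_inf_left (x y : Gamma e he) : (odot x (oplus (lneg x) y)).val = x.val ⊓ y.val := by
  rw [val_odot, val_oplus, val_lneg, add_inf]
  have h : x.val - e + (e - x.val + y.val) = y.val := by simp [sub_eq_add_neg, add_assoc]
  rw [h, sub_add_cancel, sup_eq_left.2 (le_inf y.nonneg x.nonneg), inf_comm]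

theorem val_inf_right (x y : Gamma e he) : (odot (oplus x (rneg y)) y).val = x.val ⊓ y.val := by
  rw [val_odot, val_oplus, val_rneg, sub_eq_add_neg, inf_add, inf_add]
  have h : x.val + (-y.val + e) + -e + y.val = x.val := by simp [add_assoc]
  rw [h, add_neg_cancel, zero_add, sup_eq_left.2 (le_inf x.nonneg y.nonneg)]

/-- The pseudo MV-algebra `Γ(G, e)`. -/
instance instPseudoMVAlgebra : PseudoMVAlgebra (Gamma e he) where
  oplus_assoc x y z := Gamma.ext <| by
    simp only [val_oplus, add_inf, inf_add]
    rw [inf_assoc, inf_assoc, inf_eq_right.2 (le_add_of_nonneg_left x.nonneg),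
      inf_eq_right.2 (le_add_of_nonneg_right z.nonneg), add_assoc]
  oplus_zero x := Gamma.ext <| by
    simp [val_oplus, val_zero, x.le_unit]
  zero_oplus x := Gamma.ext <| by
    simp [val_oplus, val_zero, x.le_unit]
  oplus_one x := Gamma.ext <| by
    simp [val_oplus, val_one, x.nonneg]
  one_oplus x := Gamma.ext <| by
    simp [val_oplus, val_one, x.nonneg]
  lneg_one := Gamma.ext <| by simp [val_lneg, val_one, val_zero]
  rneg_one := Gamma.ext <| by simp [val_rneg, val_one, val_zero]
  rneg_oplus_lneg x y := Gamma.ext <| by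
    simp only [val_oplus, val_lneg, val_rneg, neg_inf, sup_add, sub_eq_add_neg, add_sup]
    simp [add_assoc]
  join_comm x y := Gamma.ext <| by rw [val_sup_left, val_sup_left, sup_comm]
  join_eq x y := Gamma.ext <| by rw [val_sup_left, val_sup_right, sup_comm]
  join_comm_right x y := Gamma.ext <| by rw [val_sup_right, val_sup_right, sup_comm]
  meet_eq x y := Gamma.ext <| by rw [val_inf_left, val_inf_right]
  rneg_lneg x := Gamma.ext <| by simp [val_lneg, val_rneg]

end Gamma

/-- The ordered group of dyadic numbers `m / 2 ^ n`, as a subgroup of the reals. -/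
def dyadicGroup : AddSubgroup ℝ where
  carrier := {x | ∃ (m : ℤ) (n : ℕ), x = (m : ℝ) / 2 ^ n}
  zero_mem' := ⟨0, 0, by simp⟩
  add_mem' := by
    rintro _ _ ⟨m, n, rfl⟩ ⟨k, l, rfl⟩
    refine ⟨m * 2 ^ l + k * 2 ^ n, n + l, ?_⟩
    push_cast
    rw [pow_add]
    field_simp
  neg_mem' := by
    rintro _ ⟨m, n, rfl⟩
    exact ⟨-m, n, by push_cast; ring⟩

/-- The number `1` as an element of the dyadic group. -/
def dyadicOne : dyadicGroup := ⟨1, 1, 0, by simp⟩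

theorem isStrongUnit_dyadicOne : IsStrongUnit dyadicOne := by
  refine ⟨Subtype.coe_le_coe.1 (by simp [dyadicOne]), fun g => ?_⟩
  obtain ⟨n, hn⟩ := exists_nat_ge (g : ℝ)
  refine ⟨n + 1, by omega, Subtype.coe_le_coe.1 ?_⟩
  have : (((n + 1) • dyadicOne : dyadicGroup) : ℝ) = n + 1 := by
    simp [dyadicOne]
  rw [this]
  linarith

/-- The MV-algebra of dyadic numbers in the real interval `[0, 1]`. -/
abbrev DyadicMV : Type := Gamma dyadicOne isStrongUnit_dyadicOne

end PseudoMVAlgebra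

namespace PseudoMVAlgebra

open PMVOps

/-! ### Both negations and the two-sided order -/

section Order

variable {M : Type u} [PseudoMVAlgebra M]

/-! Put `a_n = (rⁿ(0))⁻`. Negating `r(x) ⊙ r(x) = x` gives `a_{n+1} ⊕ a_{n+1} = a_n`, with `a_0 =
1`. Strictness makes `a_1 + a_1` a partial sum, and `a_{n+1} ≤ a_1` makes all later doublings
partial sums too. Hence `a_n` is cyclic of order `2^n`, and `m / 2^n ↦ m a_n` is well defined on
dyadics.

The main tool is cancellation of partial sums (`SumDefined.left_cancel`). It makes the dyadic map
injective, since a coincidence would force `a_n = 0` and then `0 = 1`. It also shows that comparable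
cyclic elements of equal order agree; representability reduces uniqueness to chains, where all
elements are comparable. In `Γ(G, e)` cyclic of order `k` means `k g = e`, so uniqueness in `M`
becomes uniqueness of the `2^n`-th part of `e`. -/

theorem rneg_zero : rneg (0 : M) = 1 := by
  rw [← lneg_one, rneg_lneg]

theorem lneg_zero : lneg (0 : M) = 1 := by
  have h := rneg_oplus_lneg (1 : M) 1
  rw [lneg_one, rneg_one, oplus_zero] at h
  rw [← h, rneg_zero]

theorem lneg_rneg (x : M) : lneg (rneg x) = x := by
  have h := rneg_oplus_lneg x 1
  rw [lneg_one, rneg_one, oplus_zero, oplus_zero, rneg_lneg] at h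
  exact h.symm

theorem odot_eq_lneg (x y : M) : odot x y = lneg (oplus (rneg y) (rneg x)) :=
  rneg_oplus_lneg y x

theorem lneg_oplus (x y : M) : lneg (oplus x y) = odot (lneg y) (lneg x) := by
  rw [odot_eq_lneg, rneg_lneg, rneg_lneg]

theorem lneg_odot (x y : M) : lneg (odot x y) = oplus (lneg y) (lneg x) := by
  rw [odot, lneg_rneg]

theorem odot_one (x : M) : odot x 1 = x := by
  rw [odot, lneg_one, zero_oplus, rneg_lneg]

theorem one_odot (x : M) : odot 1 x = x := by
  rw [odot, lneg_one, oplus_zero, rneg_lneg]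

theorem oplus_rneg_self (x : M) : oplus x (rneg x) = 1 := by
  have h := join_comm x 1
  rwa [odot_one, one_oplus] at h

theorem lneg_oplus_self (x : M) : oplus (lneg x) x = 1 := by
  have h := join_comm_right x 1
  rw [one_odot, oplus_one] at h
  exact h.symm

theorem le_iff_lneg_oplus {x y : M} : Le x y ↔ oplus (lneg x) y = 1 := by
  refine ⟨fun h => ?_, fun h => ?_⟩
  · rw [← show join x y = y from h, join, oplus_assoc, lneg_oplus_self, one_oplus]
  · rw [Le, join, join_comm, odot, lneg_rneg, h, rneg_one, oplus_zero]

theorem le_iff_oplus_rneg {x y : M} : Le x y ↔ oplus y (rneg x) = 1 := by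
  have hj : join x y = oplus (odot x (lneg y)) y := by
    rw [join, join_comm, join_eq]
  refine ⟨fun h => ?_, fun h => ?_⟩
  · have h' : oplus (odot y (lneg x)) x = y := by
      rw [← join_comm_right, ← hj]; exact h
    rw [← h', ← oplus_assoc, oplus_rneg_self, oplus_one]
  · rw [Le, hj, odot_eq_lneg, rneg_lneg, h, lneg_one, zero_oplus]

theorem le_oplus_right (x z : M) : Le x (oplus x z) := by
  rw [le_iff_lneg_oplus, oplus_assoc, lneg_oplus_self, one_oplus]

theorem le_oplus_left (x z : M) : Le x (oplus z x) := by
  rw [le_iff_oplus_rneg, ← oplus_assoc, oplus_rneg_self, oplus_one]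

theorem Le.exists_oplus_right {x y : M} (h : Le x y) : ∃ z, oplus x z = y := ⟨_, h⟩

/-- Without commutativity, `⊕` is monotone in each argument because the order is divisibility on
either side. -/
theorem Le.exists_oplus_left {x y : M} (h : Le x y) : ∃ z, oplus z x = y := by
  refine ⟨odot y (lneg x), ?_⟩
  rw [← join_eq]
  exact h

theorem le_refl (x : M) : Le x x := by
  simpa only [oplus_zero] using le_oplus_right x 0

theorem zero_le (x : M) : Le 0 x := by
  simpa only [zero_oplus] using le_oplus_right 0 x

theorem le_one (x : M) : Le x 1 := by
  simpa only [oplus_one] using le_oplus_right x 1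

theorem Le.trans {x y z : M} (h₁ : Le x y) (h₂ : Le y z) : Le x z := by
  obtain ⟨a, rfl⟩ := h₁.exists_oplus_right
  obtain ⟨b, rfl⟩ := h₂.exists_oplus_right
  rw [← oplus_assoc]
  exact le_oplus_right _ _

theorem Le.antisymm {x y : M} (h₁ : Le x y) (h₂ : Le y x) : x = y := by
  have h : join x y = join y x := join_comm x y
  rw [← show join x y = y from h₁, h]
  exact (show join y x = x from h₂).symm

theorem Le.oplus_left {x y : M} (h : Le x y) (z : M) : Le (oplus z x) (oplus z y) := by
  obtain ⟨a, rfl⟩ := h.exists_oplus_right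
  rw [oplus_assoc]
  exact le_oplus_right _ _

theorem Le.oplus_right {x y : M} (h : Le x y) (z : M) : Le (oplus x z) (oplus y z) := by
  obtain ⟨a, rfl⟩ := h.exists_oplus_left
  rw [← oplus_assoc]
  exact le_oplus_left _ _

theorem Le.oplus {x y z w : M} (h₁ : Le x y) (h₂ : Le z w) : Le (oplus x z) (oplus y w) :=
  (h₁.oplus_right z).trans (h₂.oplus_left y)

theorem Le.lneg {x y : M} (h : Le x y) : Le (lneg y) (lneg x) := by
  rw [le_iff_oplus_rneg, rneg_lneg]
  exact le_iff_lneg_oplus.1 h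

theorem Le.rneg {x y : M} (h : Le x y) : Le (rneg y) (rneg x) := by
  rw [le_iff_lneg_oplus, lneg_rneg]
  exact le_iff_oplus_rneg.1 h

theorem Le.odot_right {x y : M} (h : Le x y) (z : M) : Le (odot x z) (odot y z) :=
  (h.lneg.oplus_left _).rneg

end Order

/-! ### Cancellation and associativity of the partial sum -/

section PartialSum

variable {M : Type u} [PseudoMVAlgebra M]

theorem SumDefined.le_rneg {x y : M} (h : SumDefined x y) : Le y (rneg x) := by
  have h' := rneg_oplus_lneg x y
  rw [le_iff_lneg_oplus.1 h, rneg_one] at h'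
  rw [le_iff_oplus_rneg, ← rneg_lneg (oplus (rneg x) (rneg y)), ← h', rneg_zero]

theorem SumDefined.mono {x y x' y' : M} (h : SumDefined x y) (hx : Le x' x) (hy : Le y' y) :
    SumDefined x' y' :=
  hx.trans (Le.trans h hy.lneg)

/-- By `meet_eq`, `(x ⊕ y) ⊙ y⁻` is the meet of `x` and `y⁻`, so a defined sum determines its
summands. -/
theorem SumDefined.oplus_odot_lneg {x y : M} (h : SumDefined x y) :
    odot (oplus x y) (lneg y) = x := by
  have h' := meet_eq x (lneg y)
  rw [rneg_lneg, le_iff_lneg_oplus.1 h, odot_one] at h'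
  exact h'.symm

theorem SumDefined.rneg_odot_oplus {x y : M} (h : SumDefined x y) :
    odot (rneg x) (oplus x y) = y := by
  have h' := meet_eq (rneg x) y
  rwa [lneg_rneg, le_iff_oplus_rneg.1 h.le_rneg, one_odot] at h'

/-- Partial sums can be cancelled on the left. -/
theorem SumDefined.left_cancel {x y z : M} (hy : SumDefined x y) (hz : SumDefined x z)
    (h : oplus x y = oplus x z) : y = z := by
  rw [← hy.rneg_odot_oplus, h, hz.rneg_odot_oplus]

/-- Adding `y` to `x ≤ z⁻ ⊙ y⁻` gives `x ⊕ y ≤ z⁻ ∨ y = z⁻`. -/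
theorem sumDefined_oplus_left {x y z : M} (hyz : SumDefined y z)
    (h : SumDefined x (oplus y z)) : SumDefined (oplus x y) z := by
  have hj : oplus (odot (lneg z) (lneg y)) y = lneg z := by
    rw [← join_eq]
    exact hyz
  have h' := Le.oplus_right h y
  rwa [lneg_oplus, hj] at h'

theorem sumDefined_oplus_right {x y z : M} (hxy : SumDefined x y)
    (h : SumDefined (oplus x y) z) : SumDefined x (oplus y z) := by
  rw [SumDefined, lneg_oplus, ← hxy.oplus_odot_lneg]
  exact Le.odot_right h _

theorem SumDefined.eq_lneg {x y : M} (h : SumDefined x y) (h1 : oplus x y = 1) :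
    x = lneg y := by
  rw [← h.oplus_odot_lneg, h1, one_odot]

theorem SumDefined.eq_rneg {x y : M} (h : SumDefined x y) (h1 : oplus x y = 1) :
    y = rneg x := by
  rw [← h.rneg_odot_oplus, h1, odot_one]

end PartialSum

/-! ### Total and partial multiples, cyclic elements -/

section Multiples

variable {M : Type u} [PseudoMVAlgebra M]

/-- The total multiple `x ⊕ ⋯ ⊕ x`. -/
def nmul (x : M) : ℕ → M
  | 0 => 0
  | n + 1 => oplus (nmul x n) x

theorem nmul_one (x : M) : nmul x 1 = x := zero_oplus x

theorem nmul_add (x : M) (m n : ℕ) : nmul x (m + n) = oplus (nmul x m) (nmul x n) := by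
  induction n with
  | zero => exact (oplus_zero _).symm
  | succ n ih => rw [← add_assoc, nmul, ih, nmul, oplus_assoc]

theorem nmul_mul (x : M) (m n : ℕ) : nmul x (m * n) = nmul (nmul x m) n := by
  induction n with
  | zero => rfl
  | succ n ih => rw [mul_add, mul_one, nmul_add, ih, nmul]

theorem nmul_zero_left (n : ℕ) : nmul (0 : M) n = 0 := by
  induction n with
  | zero => rfl
  | succ n ih => rw [nmul, ih, oplus_zero]

theorem Le.nmul {x y : M} (h : Le x y) (n : ℕ) : Le (nmul x n) (nmul y n) := by
  induction n with
  | zero => exact le_refl _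
  | succ n ih => exact ih.oplus h

theorem nmul_eq_one_of_le {x : M} {m n : ℕ} (hmn : m ≤ n) (h : nmul x m = 1) :
    nmul x n = 1 := by
  obtain ⟨k, rfl⟩ := Nat.exists_eq_add_of_le hmn
  rw [nmul_add, h, one_oplus]

/-- Splits a partial multiple into its value, computed with the total operation, and its
definedness. -/
theorem isMultiple_iff {x : M} {n : ℕ} {y : M} :
    IsMultiple x n y ↔ y = nmul x n ∧ ∀ k < n, SumDefined (nmul x k) x := by
  induction n generalizing y with
  | zero => simp [IsMultiple, nmul]
  | succ n ih =>
    simp only [IsMultiple, nmul, ih]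
    constructor
    · rintro ⟨z, ⟨rfl, h⟩, h1, rfl⟩
      refine ⟨rfl, fun k hk => ?_⟩
      rcases Nat.lt_succ_iff_lt_or_eq.1 hk with hk | rfl
      exacts [h k hk, h1]
    · rintro ⟨rfl, h⟩
      exact ⟨_, ⟨rfl, fun k hk => h k (by omega)⟩, h n (by omega), rfl⟩

theorem IsMultiple.sumDefined_nmul {x y : M} {n : ℕ} (h : IsMultiple x n y) {k l : ℕ}
    (hkl : k + l ≤ n) : SumDefined (nmul x k) (nmul x l) := by
  induction l with
  | zero => rw [nmul, SumDefined, lneg_zero]; exact le_one _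
  | succ l ih =>
    refine sumDefined_oplus_right (ih (by omega)) ?_
    rw [← nmul_add]
    exact (isMultiple_iff.1 h).2 _ (by omega)

theorem IsMultiple.of_oplus_self {x y : M} {n : ℕ} (hx : SumDefined x x)
    (h : IsMultiple (oplus x x) n y) : IsMultiple x (2 * n) y := by
  induction n generalizing y with
  | zero => exact h
  | succ n ih =>
    obtain ⟨z, hz, hd, rfl⟩ := h
    exact ⟨oplus z x, ⟨z, ih hz, hd.mono (le_refl _) (le_oplus_left _ _), rfl⟩,
      sumDefined_oplus_left hx hd, oplus_assoc _ _ _⟩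

theorem IsCyclicElement.eq_of_le {a b : M} {n : ℕ} (ha : IsCyclicElement a n)
    (hb : IsCyclicElement b n) (h : Le a b) : a = b := by
  obtain ⟨hn, ha⟩ := ha
  obtain ⟨n, rfl⟩ := Nat.exists_eq_add_of_le' hn
  have ha1 := (isMultiple_iff.1 ha).1
  obtain ⟨hb1, hb2⟩ := isMultiple_iff.1 hb.2
  have hd := hb2 n (by omega)
  -- For order `n + 1`: `1 = na ⊕ a ≤ nb ⊕ a ≤ nb ⊕ b = 1`, so `nb` cancels.
  refine SumDefined.left_cancel (hd.mono (le_refl _) h) hd (Le.antisymm (h.oplus_left _) ?_)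
  change Le (nmul b (n + 1)) _
  rw [← hb1, ha1]
  exact (h.nmul n).oplus_right _

end Multiples

/-! ### Transport along homomorphisms and uniqueness -/

section Hom

variable {M : Type u} {N : Type v} [PseudoMVAlgebra M] [PseudoMVAlgebra N] {f : M → N}

theorem IsHom.map_le (hf : IsHom f) {x y : M} (h : Le x y) : Le (f x) (f y) := by
  rw [le_iff_lneg_oplus, ← hf.map_lneg, ← hf.map_oplus, le_iff_lneg_oplus.1 h, hf.map_one]

theorem IsHom.map_nmul (hf : IsHom f) (x : M) (n : ℕ) : f (nmul x n) = nmul (f x) n := by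
  induction n with
  | zero => exact hf.map_zero
  | succ n ih => rw [nmul, hf.map_oplus, ih, nmul]

theorem IsHom.map_isCyclicElement (hf : IsHom f) {a : M} {n : ℕ} (h : IsCyclicElement a n) :
    IsCyclicElement (f a) n := by
  obtain ⟨h1, h2⟩ := isMultiple_iff.1 h.2
  refine ⟨h.1, isMultiple_iff.2 ⟨by rw [← hf.map_nmul, ← h1, hf.map_one], fun k hk => ?_⟩⟩
  rw [SumDefined, ← hf.map_nmul, ← hf.map_lneg]
  exact hf.map_le (h2 k hk)

/-- The inverse of a bijective homomorphism is a homomorphism. -/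
theorem IsHom.of_inverse (hf : IsHom f) {g : N → M} (hl : Function.LeftInverse g f)
    (hr : Function.RightInverse g f) : IsHom g where
  map_oplus x y := hl.injective (by rw [hr, hf.map_oplus, hr, hr])
  map_lneg x := hl.injective (by rw [hr, hf.map_lneg, hr])
  map_rneg x := hl.injective (by rw [hr, hf.map_rneg, hr])
  map_zero := hl.injective (by rw [hr, hf.map_zero])
  map_one := hl.injective (by rw [hr, hf.map_one])

/-- In a representable pseudo MV-algebra there is at most one cyclic element of each order. -/
theorem IsRepresentable.isCyclicElement_unique (hM : IsRepresentable M) {a b : M} {n : ℕ}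
    (ha : IsCyclicElement a n) (hb : IsCyclicElement b n) : a = b := by
  obtain ⟨ι, A, hA, f, hchain, hf, -, hinj⟩ := hM
  refine hinj a b fun i => ?_
  have ha' := (hf i).map_isCyclicElement ha
  have hb' := (hf i).map_isCyclicElement hb
  rcases hchain i (f i a) (f i b) with h | h
  exacts [ha'.eq_of_le hb' h, (hb'.eq_of_le ha' h).symm]

end Hom

/-! ### Iterated halves of the unit -/

section SquareRoot

variable {M : Type u} [PseudoMVAlgebra M] {r : M → M}

/-- The element `2⁻ⁿ`, obtained as the negation of the `n`-th iterate of `r` at `0`. -/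
def halfPow (r : M → M) (n : ℕ) : M := lneg (r^[n] 0)

theorem halfPow_zero : halfPow r 0 = 1 := lneg_zero

theorem IsWeakSquareRoot.halfPow_succ_oplus_self (hr : IsWeakSquareRoot r) (n : ℕ) :
    oplus (halfPow r (n + 1)) (halfPow r (n + 1)) = halfPow r n := by
  simp only [halfPow, Function.iterate_succ_apply']
  rw [← lneg_odot, hr.odot_self]

theorem IsWeakSquareRoot.sumDefined_halfPow_succ (hr : IsWeakSquareRoot r) (hs : IsStrict r)
    (n : ℕ) : SumDefined (halfPow r (n + 1)) (halfPow r (n + 1)) := by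
  induction n with
  | zero =>
    change Le (lneg (r 0)) (lneg (lneg (r 0)))
    rw [← show r 0 = lneg (r 0) from hs, ← show r 0 = lneg (r 0) from hs]
    exact le_refl _
  | succ n ih =>
    have h : Le (halfPow r (n + 1 + 1)) (halfPow r (n + 1)) := by
      rw [← hr.halfPow_succ_oplus_self (n + 1)]
      exact le_oplus_left _ _
    exact ih.mono h h

theorem IsWeakSquareRoot.isCyclicElement_halfPow (hr : IsWeakSquareRoot r) (hs : IsStrict r)
    (n : ℕ) : IsCyclicElement (halfPow r n) (2 ^ n) := by
  refine ⟨by positivity, ?_⟩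
  induction n with
  | zero =>
    refine ⟨0, rfl, zero_le _, ?_⟩
    rw [zero_oplus, halfPow_zero]
  | succ n ih =>
    rw [pow_succ, mul_comm]
    refine IsMultiple.of_oplus_self (hr.sumDefined_halfPow_succ hs n) ?_
    rwa [hr.halfPow_succ_oplus_self]

theorem IsWeakSquareRoot.nmul_halfPow_add (hr : IsWeakSquareRoot r) (n k m : ℕ) :
    nmul (halfPow r (n + k)) (2 ^ k * m) = nmul (halfPow r n) m := by
  induction k generalizing m with
  | zero => simp
  | succ k ih =>
    rw [pow_succ', mul_assoc, nmul_mul, ← ih, ← add_assoc]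
    congr 1
    rw [nmul, nmul_one, hr.halfPow_succ_oplus_self]

theorem IsWeakSquareRoot.nmul_halfPow_eq (hr : IsWeakSquareRoot r) {m n k l : ℕ}
    (h : (m : ℝ) / 2 ^ n = k / 2 ^ l) : nmul (halfPow r n) m = nmul (halfPow r l) k := by
  rw [div_eq_div_iff (by positivity) (by positivity)] at h
  have h' : 2 ^ l * m = 2 ^ n * k := by
    rw [mul_comm, mul_comm _ k]
    exact_mod_cast h
  rw [← hr.nmul_halfPow_add n l m, h', add_comm n l, hr.nmul_halfPow_add]

theorem IsCyclicElement.nmul_injOn (hM : (0 : M) ≠ 1) {a : M} {n m k : ℕ}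
    (h : IsCyclicElement a n) (hm : m ≤ n) (hk : k ≤ n) (hmk : nmul a m = nmul a k) :
    m = k := by
  wlog hle : m ≤ k generalizing m k
  · exact (this hk hm hmk.symm (by omega)).symm
  obtain ⟨j, rfl⟩ := Nat.exists_eq_add_of_le hle
  rcases j with _ | j
  · rfl
  exfalso
  -- Cancel `ma` from `ma + (j + 1)a = ma + 0`.
  have h0 : nmul a (j + 1) = 0 := by
    refine SumDefined.left_cancel (h.2.sumDefined_nmul hk)
      (h.2.sumDefined_nmul (l := 0) hm) ?_
    rw [← nmul_add, ← hmk]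
    exact (oplus_zero _).symm
  have ha : a = 0 := by
    refine Le.antisymm ?_ (zero_le a)
    rw [← h0]
    exact le_oplus_left _ _
  apply hM
  rw [(isMultiple_iff.1 h.2).1, ha, nmul_zero_left]

end SquareRoot

/-! ### The dyadic embedding -/

section Dyadic

theorem DyadicMV.exists_eq_div (x : DyadicMV) :
    ∃ m n : ℕ, ((x.val : dyadicGroup) : ℝ) = m / 2 ^ n := by
  obtain ⟨m, n, h⟩ := x.val.2
  have h0 : (0 : ℝ) ≤ (x.val : ℝ) := x.nonneg
  rw [h] at h0
  have hm : 0 ≤ m := by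
    by_contra! hm
    have : (m : ℝ) < 0 := by exact_mod_cast hm
    exact absurd h0 (not_le.2 (div_neg_of_neg_of_pos this (by positivity)))
  lift m to ℕ using hm
  exact ⟨m, n, by simpa using h⟩

theorem DyadicMV.exists_eq_div₂ (x y : DyadicMV) :
    ∃ m k n : ℕ, m ≤ 2 ^ n ∧ k ≤ 2 ^ n ∧
      (x.val : ℝ) = m / 2 ^ n ∧ (y.val : ℝ) = k / 2 ^ n := by
  obtain ⟨m, n, hx⟩ := DyadicMV.exists_eq_div x
  obtain ⟨k, l, hy⟩ := DyadicMV.exists_eq_div y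
  have hx' : (x.val : ℝ) = (m * 2 ^ l : ℕ) / 2 ^ (n + l) := by
    rw [hx, pow_add]; push_cast; field_simp
  have hy' : (y.val : ℝ) = (k * 2 ^ n : ℕ) / 2 ^ (n + l) := by
    rw [hy, pow_add]; push_cast; field_simp
  have key : ∀ (z : DyadicMV) (j : ℕ), (z.val : ℝ) = j / 2 ^ (n + l) → j ≤ 2 ^ (n + l) := by
    intro z j hz
    have h1 : (z.val : ℝ) ≤ ((1 : ℤ) : ℝ) := by
      simpa [dyadicOne] using Subtype.coe_le_coe.2 z.le_unit
    rw [hz, Int.cast_one, div_le_one (by positivity)] at h1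
    exact_mod_cast h1
  exact ⟨_, _, _, key x _ hx', key y _ hy', hx', hy'⟩

variable {M : Type u} [PseudoMVAlgebra M] {r : M → M}

theorem IsWeakSquareRoot.exists_dyadic_embedding (hr : IsWeakSquareRoot r) (hs : IsStrict r)
    (hM : (0 : M) ≠ 1) : ∃ f : DyadicMV → M, IsHom f ∧ Function.Injective f := by
  choose m n hmn using DyadicMV.exists_eq_div
  let f : DyadicMV → M := fun x => nmul (halfPow r (n x)) (m x)
  have hf : ∀ (x : DyadicMV) (k l : ℕ), (x.val : ℝ) = k / 2 ^ l → f x = nmul (halfPow r l) k :=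
    fun x k l h => hr.nmul_halfPow_eq ((hmn x).symm.trans h)
  have hc := hr.isCyclicElement_halfPow hs
  have hc1 : ∀ n, nmul (halfPow r n) (2 ^ n) = 1 := fun n => (isMultiple_iff.1 (hc n).2).1.symm
  have hone : ((dyadicOne : dyadicGroup) : ℝ) = 1 := rfl
  -- A partial sum equal to `1` makes each summand a negation of the other, so this one fact gives
  -- both negations.
  have hcompl : ∀ (x y : DyadicMV), (x.val : ℝ) + y.val = 1 →
      SumDefined (f x) (f y) ∧ oplus (f x) (f y) = 1 := by
    intro x y hxy
    obtain ⟨k, l, j, -, -, hx, hy⟩ := DyadicMV.exists_eq_div₂ x y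
    rw [hx, hy, ← add_div, div_eq_one_iff_eq (by positivity)] at hxy
    have hkl : k + l = 2 ^ j := by exact_mod_cast hxy
    rw [hf x _ _ hx, hf y _ _ hy, ← nmul_add, hkl]
    exact ⟨(hc j).2.sumDefined_nmul hkl.le, hc1 j⟩
  refine ⟨f, ⟨fun x y => ?_, fun x => ?_, fun x => ?_, ?_, ?_⟩, fun x y hxy => ?_⟩
  · obtain ⟨k, l, j, -, -, hx, hy⟩ := DyadicMV.exists_eq_div₂ x y
    rw [hf x _ _ hx, hf y _ _ hy, ← nmul_add]
    rcases le_total (x.val + y.val) dyadicOne with h | h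
    · refine hf _ _ _ ?_
      rw [Gamma.val_oplus, inf_eq_left.2 h, AddSubgroup.coe_add, hx, hy]
      push_cast
      ring
    -- Truncated case: the numerators add up to at least `2^j`, and multiples of `a_j` stay at `1`
    -- from there on.
    · have h' : (1 : ℝ) ≤ (x.val : ℝ) + y.val := h
      rw [hx, hy, ← add_div, one_le_div (by positivity)] at h'
      rw [nmul_eq_one_of_le (by exact_mod_cast h') (hc1 j), ← hc1 0]
      refine hf _ _ _ ?_
      rw [Gamma.val_oplus, inf_eq_right.2 h, hone]
      simp
  · obtain ⟨h1, h2⟩ := hcompl (lneg x) x (by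
      rw [Gamma.val_lneg, AddSubgroup.coe_sub, hone, sub_add_cancel])
    exact h1.eq_lneg h2
  · obtain ⟨h1, h2⟩ := hcompl x (rneg x) (by
      rw [Gamma.val_rneg, AddSubgroup.coe_add, AddSubgroup.coe_neg, hone, add_neg_cancel_left])
    exact h1.eq_rneg h2
  · rw [hf 0 0 0 (by simp [Gamma.val_zero])]
    rfl
  · rw [hf 1 1 0 (by simp [Gamma.val_one, hone]), nmul_one, halfPow_zero]
  · obtain ⟨k, l, j, hk, hl, hx, hy⟩ := DyadicMV.exists_eq_div₂ x y
    rw [hf x _ _ hx, hf y _ _ hy] at hxy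
    obtain rfl := (hc j).nmul_injOn hM hk hl hxy
    exact Gamma.ext (Subtype.ext (hx.trans hy.symm))

end Dyadic

/-! ### Cyclic elements of `Γ(G, e)` -/

section UnitalGroup

variable {G : Type u} [AddGroup G] [Lattice G] [AddLeftMono G] [AddRightMono G]

theorem nonneg_of_two_pow_nsmul_nonneg {g : G} (n : ℕ) (h : 0 ≤ (2 ^ n) • g) : 0 ≤ g := by
  induction n with
  | zero => simpa using h
  | succ n ih =>
    rw [pow_succ, mul_nsmul, two_nsmul] at h
    refine ih ?_
    generalize (2 ^ n) • g = x at h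
    -- The left side expands to `2x ∧ x ∧ 0`, where `2x ≥ 0` can be dropped; an idempotent of a
    -- group is `0`.
    have h1 : (x ⊓ 0) + (x ⊓ 0) = x ⊓ 0 := by
      rw [add_inf, inf_add, inf_add, add_zero, zero_add, add_zero, inf_assoc, ← inf_assoc x,
        inf_idem, inf_comm x, ← inf_assoc, inf_eq_right.2 h, inf_comm]
    exact inf_eq_right.1 (add_eq_left.1 h1)

variable {e : G} {he : IsStrongUnit e}

theorem Gamma.le_iff {x y : Gamma e he} : Le x y ↔ x.val ≤ y.val := by
  rw [Le, join, Gamma.ext_iff, Gamma.val_sup_left, sup_eq_right]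

theorem Gamma.sumDefined_iff {x y : Gamma e he} : SumDefined x y ↔ x.val + y.val ≤ e := by
  rw [SumDefined, Gamma.le_iff, Gamma.val_lneg, le_sub_iff_add_le]

theorem Gamma.isMultiple_iff_nsmul {x y : Gamma e he} {n : ℕ} :
    IsMultiple x n y ↔ n • x.val = y.val := by
  induction n generalizing y with
  | zero =>
    rw [IsMultiple, Gamma.ext_iff, Gamma.val_zero, zero_nsmul, eq_comm]
  | succ n ih =>
    simp only [IsMultiple, ih, Gamma.sumDefined_iff, succ_nsmul]
    constructor
    · rintro ⟨z, hz, hle, rfl⟩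
      rw [hz, Gamma.val_oplus, inf_eq_left.2 hle]
    · intro h
      have hle : n • x.val + x.val ≤ e := h.le.trans y.le_unit
      refine ⟨⟨n • x.val, nsmul_nonneg x.nonneg n,
        (le_add_of_nonneg_right x.nonneg).trans hle⟩, rfl, hle, Gamma.ext ?_⟩
      rw [Gamma.val_oplus, inf_eq_left.2 hle, h]

theorem Gamma.isCyclicElement_iff {x : Gamma e he} {n : ℕ} (hn : 0 < n) :
    IsCyclicElement x n ↔ n • x.val = e := by
  rw [IsCyclicElement, Gamma.isMultiple_iff_nsmul, and_iff_right hn, Gamma.val_one]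

end UnitalGroup

end PseudoMVAlgebra

open PseudoMVAlgebra in
theorem mainTheorem12 {M : Type u} [PseudoMVAlgebra M] (hM : (0 : M) ≠ 1)
    (hrep : IsRepresentable M) (r : M → M)
    (hr : (IsSymmetric M ∧ IsSquareRoot r) ∨ IsWeakSquareRoot r) (hstrict : IsStrict r) :
    (∃ f : DyadicMV → M, IsHom f ∧ Function.Injective f) ∧
    ∀ n : ℕ, 1 ≤ n → ∃ a : M,
      IsCyclicElement a (2 ^ n) ∧
      (∀ b : M, IsCyclicElement b (2 ^ n) → b = a) ∧
      ∀ (G : Type v) [AddGroup G] [Lattice G] [AddLeftMono G] [AddRightMono G]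
        (e : G) (he : IsStrongUnit e) (φ : M → Gamma e he),
        IsHom φ → Function.Bijective φ →
          ∀ g : G, (2 ^ n) • g = e ↔ g = (φ a).val := by
  have hw : IsWeakSquareRoot r := hr.elim (fun h => h.2.toIsWeakSquareRoot) id
  refine ⟨hw.exists_dyadic_embedding hstrict hM, fun n _ => ?_⟩
  have ha := hw.isCyclicElement_halfPow hstrict n
  have huniq : ∀ b : M, IsCyclicElement b (2 ^ n) → b = halfPow r n :=
    fun b hb => hrep.isCyclicElement_unique hb ha
  refine ⟨halfPow r n, ha, huniq, ?_⟩
  intro G _ _ _ _ e he φ hφ hbij g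
  have hn : 0 < 2 ^ n := by positivity
  constructor
  · intro hg
    -- Any solution `g` in `G` lies in `[0, e]`, so it is a cyclic element of `Γ(G, e)` and can be
    -- pulled back to `M`.
    have hg0 : 0 ≤ g := nonneg_of_two_pow_nsmul_nonneg n (hg ▸ he.1)
    have hge : g ≤ e := by
      rw [← hg]
      exact le_self_nsmul hg0 hn.ne'
    obtain ⟨ψ, hl, hr⟩ := Function.bijective_iff_has_inverse.1 hbij
    let x : Gamma e he := ⟨g, hg0, hge⟩
    have hx : IsCyclicElement x (2 ^ n) := (Gamma.isCyclicElement_iff hn).2 hg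
    have h := huniq _ ((hφ.of_inverse hl hr).map_isCyclicElement hx)
    rw [← h, hr]
  · rintro rfl
    exact (Gamma.isCyclicElement_iff hn).1 (hφ.map_isCyclicElement ha)
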